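/- Let $k\ge 2$ and $\ell\ge 1$. A source is connected to a destination by $k$ parallel paths, each a line of $\ell$ links; time is slotted. In each slot link $j$ of path $i$ erases with probability $p_{ij}\in[0,1)$, independently over all links and slots, and at least one $p_{ij}$ is positive. Put $q_i=\max_{1\le j\le\ell}p_{ij}$ and $C=k-\sum_{i=1}^k q_i$. For each $n$, routing of $n$ packets assigns to path $i$, in advance, a number $a_i(n)$ of packets proportional to the capacity $1-q_i$ of the path, up to rounding: $a_i(n)$ is a nonnegative integer with $|a_i(n)-n(1-q_i)/C|\le 1$. The packets are then sent hop by hop with retransmissions: in each slot every node of a path that holds a packet not yet received by the next node transmits one such packet; if the link does not erase, the packet moves to the next node, where it can be forwarded from the next slot on, and otherwise it stays and is retransmitted later. Let $T^{\mathrm r}_n$ be the number of slots until all packets have reached the destination. Then $\mathbb E\,T^{\mathrm r}_n<\infty$ and $$\mathbb E\,T^{\mathrm r}_n=\frac{n}{k-\sum_{i=1}^k\max_{1\le j\le \ell}p_{ij}}+D^{\mathrm r}_n ,$$ where the delay function $D^{\mathrm r}_n$ depends only on $n$, the erasure probabilities $p_{ij}$ and the rounding chosen, is sublinear, $D^{\mathrm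 r}_n=o(n)$, and satisfies $D^{\mathrm r}_n\in\Omega(\sqrt n)$: there is $c>0$ such that $D^{\mathrm r}_n\ge c\sqrt n$ for all sufficiently large $n$. -/

import Mathlib

open MeasureTheory ProbabilityTheory Filter Asymptotics
open scoped ENNReal

namespace ParallelRouting

/-- Hop-by-hop routing with retransmissions along one line network with nodes `0, …, ℓ`
(`0` is the source, `ℓ` the destination) and links `j : Fin ℓ` from node `j.castSucc` to node
`j.succ`. The source initially holds `a` packets, and `x t j = true` means that link `j` erases
in time slot `t`. The value `received a x t v` is the number of packets that node `v` has obtained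
before slot `t`. In each slot, every node whose buffer is nonempty (it has obtained more packets
than it has already passed on) transmits one buffered packet on its outgoing link; if the link
does not erase, the packet moves to the next node, where it is available from the next slot on,
and otherwise it is kept and transmitted again. -/
def received {ℓ : ℕ} (a : ℕ) (x : ℕ → Fin ℓ → Bool) : ℕ → Fin (ℓ + 1) → ℕ
  | 0 => Fin.cons a (fun _ => 0)
  | t + 1 => Fin.cons a (fun j =>
      received a x t j.succ +
        if x t j = false ∧ received a x t j.succ < received a x t j.castSucc then 1 else 0)

/-- In the network of `k` parallel paths with `ℓ` links each, where path `i` has to carry `a i`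
packets, all packets have reached the common destination after `t` slots. -/
def Delivered {k ℓ : ℕ} (a : Fin k → ℕ) (x : ℕ → Fin k → Fin ℓ → Bool) (t : ℕ) : Prop :=
  ∀ i, received (a i) (fun s j => x s i j) t (Fin.last ℓ) = a i

/-- The completion time: the least number of slots after which all packets are delivered
(`⊤` if this never happens). -/
noncomputable def completionTime {k ℓ : ℕ} (a : Fin k → ℕ) (x : ℕ → Fin k → Fin ℓ → Bool) : ℕ∞ :=
  ⨅ (t : ℕ) (_ : Delivered a x t), (t : ℕ∞)

/-- `X t i j` tells whether link `j` of path `i` erases in slot `t`: the erasures of different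
links and different slots are independent, and link `j` of path `i` erases with probability
`p i j`. -/
structure IsErasureProcess {k ℓ : ℕ} (p : Fin k → Fin ℓ → ℝ) {Ω : Type*} [MeasurableSpace Ω]
    (P : Measure Ω) (X : ℕ → Fin k → Fin ℓ → Ω → Bool) : Prop where
  measurable : ∀ t i j, Measurable (X t i j)
  indep : iIndepFun (fun e : ℕ × Fin k × Fin ℓ => X e.1 e.2.1 e.2.2) P
  prob : ∀ t i j, P.real {ω | X t i j ω = true} = p i j

/-- The capacity of the network: `k - ∑ i, max_j p i j`. -/
noncomputable def capacity {k ℓ : ℕ} (p : Fin k → Fin ℓ → ℝ) : ℝ :=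
  (k : ℝ) - ∑ i, ⨆ j, p i j

/-- The share of `n` packets that is proportional to the capacity `1 - max_j p i j` of path `i`.
It need not be an integer. -/
noncomputable def share {k ℓ : ℕ} (p : Fin k → Fin ℓ → ℝ) (n : ℕ) (i : Fin k) : ℝ :=
  (n : ℝ) * (1 - ⨆ j, p i j) / capacity p

/-- The numbers `a i` of packets sent along the paths are the proportional shares of `n` packets,
up to rounding. This includes the exact shares when they are integers, rounding to the nearest
integers, and every rounding up or down of the shares for which the total is exactly `n`. -/
def IsProportionalSplit {k ℓ : ℕ} (p : Fin k → Fin ℓ → ℝ) (n : ℕ) (a : Fin k → ℕ) : Prop :=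
  ∀ i, |(a i : ℝ) - share p n i| ≤ 1

end ParallelRouting

/-! The completion time `T` is the sum over `t` of the indicator `busy` that delivery is unfinished
after `t` slots, so `E T` is the sum of `busyProb`. This sum depends only on the law of the
erasures, and the delay is the sum minus `n / C`. Let `s i` be the success probability of a worst
link of path `i`. Up to rounding, all the ratios `a i / s i` equal `n / C`.

Upper bound: the potential `z ^ (packets still missing at v) - 1` satisfies a linear recursion in
expectation. It makes `busyProb` decay exponentially beyond `(1 + δ)² y` slots if `a i ≤ s i * y`
(`integral_potential_le`, `busyProb_le_exp`). Hence `E T ≤ (1 + δ)² n / C + O_δ(1)` for every `δ >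
0`, which gives finiteness and `o(n)`.

Lower bound: completion waits for the slower of two paths. Let `W` be the centred walk of successes
on a worst link of path `i₁`, over its first `m = a i₁` slots; delivery cannot end sooner. If `W <
0`, bound `T` from below by the load of path `i₁`, otherwise by that of another path `i₂`. In
expectation (optional stopping) the first choice gains `E W⁻ = E |W| / 2` over `n / C`; the second
loses nothing, because `W` is independent of path `i₂` (`le_sum_busyProb`). Second and fourth
moments give `E |W| ≥ c √m`, and `m` is of order `n`. -/

namespace ParallelRouting

/-- The law of a bit that is `true` with probability `r`. -/
noncomputable def bernoulliBit (r : ℝ) : Measure Bool :=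
  ENNReal.ofReal r • Measure.dirac true + ENNReal.ofReal (1 - r) • Measure.dirac false

lemma isProbabilityMeasure_bernoulliBit {r : ℝ} (h0 : 0 ≤ r) (h1 : r ≤ 1) :
    IsProbabilityMeasure (bernoulliBit r) := by
  constructor
  simp only [bernoulliBit, Measure.add_apply, Measure.smul_apply, measure_univ, smul_eq_mul,
    mul_one]
  rw [← ENNReal.ofReal_add h0 (by linarith)]
  simp

lemma integral_bernoulliBit {r : ℝ} (h0 : 0 ≤ r) (h1 : r ≤ 1) (f : Bool → ℝ) :
    ∫ b, f b ∂bernoulliBit r = r * f true + (1 - r) * f false := by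
  rw [bernoulliBit, integral_add_measure
    ((integrable_dirac (by simp)).smul_measure ENNReal.ofReal_ne_top)
    ((integrable_dirac (by simp)).smul_measure ENNReal.ofReal_ne_top),
    integral_smul_measure, integral_smul_measure, integral_dirac, integral_dirac,
    ENNReal.toReal_ofReal h0, ENNReal.toReal_ofReal (by linarith)]
  rfl

lemma map_eq_bernoulliBit {Ω : Type*} [MeasurableSpace Ω] {P : Measure Ω} [IsProbabilityMeasure P]
    {X : Ω → Bool} (hX : Measurable X) {r : ℝ} (h : P.real {ω | X ω = true} = r) :
    P.map X = bernoulliBit r := by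
  have ht : P (X ⁻¹' {true}) = ENNReal.ofReal r := by
    rw [← h, ofReal_measureReal]; rfl
  have hf : P (X ⁻¹' {false}) = ENNReal.ofReal (1 - r) := by
    have : X ⁻¹' {false} = (X ⁻¹' {true})ᶜ := by ext; simp
    rw [this, ← ofReal_measureReal, probReal_compl_eq_one_sub (hX (by simp)), ← h]
    rfl
  refine Measure.ext_of_singleton fun b => ?_
  rw [Measure.map_apply hX (by simp)]
  cases b
  · simp [bernoulliBit, hf]
  · simp [bernoulliBit, ht]

/-! ### Functions of finitely many independent bits -/

section Bits

variable {E : Type*}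

/-- The law of a family of independent bits, where bit `e` is `true` with probability `r e`. -/
noncomputable def bitsMeasure (r : E → ℝ) : Measure (E → Bool) :=
  Measure.infinitePi fun e => bernoulliBit (r e)

/-- Such a function factors through a finite discrete space; this is the source of all measurability
and integrability below. -/
lemma measurable_of_dependsOn {β : Type*} [MeasurableSpace β] [Nonempty β] {G : (E → Bool) → β}
    {S : Finset E} (hG : DependsOn G (S : Set E)) : Measurable G := by
  obtain ⟨g, rfl⟩ := dependsOn_iff_exists_comp.1 hG
  have : Finite ((i : (S : Set E)) → Bool) := inferInstance
  exact (measurable_of_finite g).comp (by fun_prop)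

variable {r : E → ℝ}

lemma isProbabilityMeasure_bitsMeasure (h0 : ∀ e, 0 ≤ r e) (h1 : ∀ e, r e ≤ 1) :
    IsProbabilityMeasure (bitsMeasure r) := by
  have := fun e => isProbabilityMeasure_bernoulliBit (h0 e) (h1 e)
  unfold bitsMeasure
  infer_instance

lemma integrable_of_dependsOn (h0 : ∀ e, 0 ≤ r e) (h1 : ∀ e, r e ≤ 1)
    {G : (E → Bool) → ℝ} {S : Finset E}
    (hG : DependsOn G (S : Set E)) : Integrable G (bitsMeasure r) := by
  have := isProbabilityMeasure_bitsMeasure h0 h1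
  have hm := measurable_of_dependsOn hG
  obtain ⟨g, rfl⟩ := dependsOn_iff_exists_comp.1 hG
  obtain ⟨C, hC⟩ := (Set.finite_range fun y => ‖g y‖).bddAbove
  exact Integrable.of_bound hm.aestronglyMeasurable C
    (ae_of_all _ fun x => hC ⟨_, rfl⟩)

lemma integral_comp_eval (h0 : ∀ e, 0 ≤ r e) (h1 : ∀ e, r e ≤ 1)
    (φ : Bool → ℝ) (e : E) :
    ∫ x, φ (x e) ∂bitsMeasure r = r e * φ true + (1 - r e) * φ false := by
  have := fun e => isProbabilityMeasure_bernoulliBit (h0 e) (h1 e)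
  rw [← integral_bernoulliBit (h0 e) (h1 e),
    ← Measure.infinitePi_map_eval (fun e => bernoulliBit (r e)) e,
    integral_map (measurable_pi_apply e).aemeasurable (measurable_of_finite φ).aestronglyMeasurable]
  rfl

/-- The form in which independence is used throughout: a bit that `G` does not look at factors out.
It takes the place of conditional expectations and martingales. -/
lemma integral_comp_eval_mul (h0 : ∀ e, 0 ≤ r e) (h1 : ∀ e, r e ≤ 1)
    (φ : Bool → ℝ) {e : E} {G : (E → Bool) → ℝ} {S : Finset E}
    (hG : DependsOn G (S : Set E)) (he : e ∉ S) :
    ∫ x, φ (x e) * G x ∂bitsMeasure r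
      = (r e * φ true + (1 - r e) * φ false) * ∫ x, G x ∂bitsMeasure r := by
  have := fun e => isProbabilityMeasure_bernoulliBit (h0 e) (h1 e)
  have hG' := measurable_of_dependsOn hG
  obtain ⟨g, rfl⟩ := dependsOn_iff_exists_comp.1 hG
  have hind : iIndepFun (fun (e : E) (x : E → Bool) => x e) (bitsMeasure r) :=
    iIndepFun_infinitePi (X := fun _ b => b) (by fun_prop)
  have hd : Disjoint {e} S := by simpa using he
  have h2 := (hind.indepFun_finset {e} S hd (by fun_prop)).comp
    (φ := fun y : (({e} : Finset E) → Bool) => φ (y ⟨e, by simp⟩))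
    (ψ := fun y : (S → Bool) => g y)
    (measurable_of_finite _) (measurable_of_finite _)
  rw [← integral_comp_eval h0 h1]
  refine h2.integral_fun_mul_eq_mul_integral
    (Measurable.aestronglyMeasurable ?_) hG'.aestronglyMeasurable
  exact (measurable_of_finite φ).comp (measurable_pi_apply e)

end Bits

end ParallelRouting

namespace ParallelRouting

/-! ### Deterministic dynamics of one path -/

section Line

variable {ℓ : ℕ} (a : ℕ) (x : ℕ → Fin ℓ → Bool)

@[simp] lemma received_source (t : ℕ) : received a x t 0 = a := by
  cases t <;> simp [received]

@[simp] lemma received_zero_succ (j : Fin ℓ) : received a x 0 j.succ = 0 := by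
  simp [received]

lemma received_succ_succ (t : ℕ) (j : Fin ℓ) :
    received a x (t + 1) j.succ = received a x t j.succ +
      if x t j = false ∧ received a x t j.succ < received a x t j.castSucc then 1 else 0 := by
  simp [received]

lemma received_le_succ (t : ℕ) (v : Fin (ℓ + 1)) :
    received a x t v ≤ received a x (t + 1) v := by
  cases v using Fin.cases with
  | zero => simp
  | succ j => rw [received_succ_succ]; omega

lemma received_monotone (v : Fin (ℓ + 1)) : Monotone fun t => received a x t v :=
  monotone_nat_of_le_succ fun t => received_le_succ a x t v

lemma received_succ_le_castSucc (t : ℕ) (j : Fin ℓ) :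
    received a x t j.succ ≤ received a x t j.castSucc := by
  induction t with
  | zero => simp
  | succ t ih =>
    have := received_le_succ a x t j.castSucc
    rw [received_succ_succ]
    split_ifs <;> omega

lemma received_antitone (t : ℕ) : Antitone (received a x t) :=
  Fin.antitone_iff_succ_le.2 fun j => received_succ_le_castSucc a x t j

lemma received_le (t : ℕ) (v : Fin (ℓ + 1)) : received a x t v ≤ a := by
  simpa using received_antitone a x t (Fin.zero_le v)

lemma received_succ_le_sum (t : ℕ) (j : Fin ℓ) :
    received a x t j.succ ≤ ∑ s ∈ Finset.range t, if x s j = false then 1 else 0 := by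
  induction t with
  | zero => simp
  | succ t ih =>
    rw [received_succ_succ, Finset.sum_range_succ]
    gcongr
    split_ifs <;> simp_all

lemma received_last_le_sum (t : ℕ) (j : Fin ℓ) :
    received a x t (Fin.last ℓ) ≤ ∑ s ∈ Finset.range t, if x s j = false then 1 else 0 :=
  (received_antitone a x t (Fin.le_last _)).trans (received_succ_le_sum a x t j)

lemma received_congr {x y : ℕ → Fin ℓ → Bool} {t : ℕ} (h : ∀ s < t, x s = y s) :
    received a x t = received a y t := by
  induction t with
  | zero => rfl
  | succ t ih =>
    simp only [received, ih fun s hs => h s (hs.trans t.lt_succ_self), h t t.lt_succ_self]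

end Line

/-! ### Delivery and the completion time -/

section Network

variable {k ℓ : ℕ}

/-- The erasure pattern of the network given by a family of bits. -/
def pattern (x : ℕ × Fin k × Fin ℓ → Bool) (t : ℕ) (i : Fin k) (j : Fin ℓ) : Bool := x (t, i, j)

lemma Delivered.mono {a : Fin k → ℕ} {x : ℕ → Fin k → Fin ℓ → Bool} {t u : ℕ} (htu : t ≤ u)
    (h : Delivered a x t) : Delivered a x u := fun i =>
  le_antisymm (received_le _ _ _ _) ((h i).symm.le.trans (received_monotone _ _ _ htu))

/-- A link passes at most one packet per slot. Thus `busy` is deterministic in the first `a i`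
slots, which the lower bound relies on. -/
lemma Delivered.le (hℓ : 1 ≤ ℓ) {a : Fin k → ℕ} {x : ℕ → Fin k → Fin ℓ → Bool} {t : ℕ}
    (h : Delivered a x t) (i : Fin k) : a i ≤ t := by
  rw [← h i]
  refine (received_last_le_sum _ _ t ⟨0, hℓ⟩).trans ?_
  refine (Finset.sum_le_card_nsmul _ _ 1 fun s _ => by split_ifs <;> simp).trans (by simp)

open Classical in
/-- The indicator of the event that some packet has not been delivered before slot `t`. -/
noncomputable def busy (a : Fin k → ℕ) (t : ℕ) (x : ℕ × Fin k × Fin ℓ → Bool) : ℝ :=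
  if Delivered a (pattern x) t then 0 else 1

/-- The links, labelled with the slots before slot `t`. -/
def before (k ℓ t : ℕ) : Finset (ℕ × Fin k × Fin ℓ) := Finset.range t ×ˢ Finset.univ

@[simp] lemma mem_before {t : ℕ} {e : ℕ × Fin k × Fin ℓ} : e ∈ before k ℓ t ↔ e.1 < t := by
  simp [before]

lemma dependsOn_received (a : ℕ) (t : ℕ) (i : Fin k) :
    DependsOn (fun x : ℕ × Fin k × Fin ℓ → Bool => received a (fun s j => pattern x s i j) t)
      (before k ℓ t : Set (ℕ × Fin k × Fin ℓ)) := fun x y h =>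
  received_congr a fun s hs => funext fun j => h (s, i, j) (by simpa using hs)

lemma dependsOn_busy (a : Fin k → ℕ) (t : ℕ) :
    DependsOn (busy a t) (before k ℓ t : Set (ℕ × Fin k × Fin ℓ)) := fun x y h => by
  have : Delivered a (pattern x) t ↔ Delivered a (pattern y) t :=
    forall_congr' fun i => by rw [show received _ _ _ = _ from dependsOn_received (a i) t i h]
  unfold busy
  split_ifs <;> tauto

lemma busy_nonneg (a : Fin k → ℕ) (t : ℕ) (x : ℕ × Fin k × Fin ℓ → Bool) : 0 ≤ busy a t x := by
  unfold busy; split_ifs <;> simp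

lemma busy_le_one (a : Fin k → ℕ) (t : ℕ) (x : ℕ × Fin k × Fin ℓ → Bool) : busy a t x ≤ 1 := by
  unfold busy; split_ifs <;> simp

lemma busy_eq_one (hℓ : 1 ≤ ℓ) {a : Fin k → ℕ} {t : ℕ} {i : Fin k} (h : t < a i)
    (x : ℕ × Fin k × Fin ℓ → Bool) : busy a t x = 1 :=
  if_neg fun hd => (hd.le hℓ i).not_gt h

lemma completionTime_eq_tsum (a : Fin k → ℕ) (x : ℕ × Fin k × Fin ℓ → Bool) :
    (completionTime a (pattern x) : ℝ≥0∞) = ∑' t, ENNReal.ofReal (busy a t x) := by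
  classical
  by_cases h : ∃ t, Delivered a (pattern x) t
  · have h1 : completionTime a (pattern x) = (Nat.find h : ℕ∞) := by
      refine le_antisymm (iInf₂_le _ (Nat.find_spec h)) (le_iInf₂ fun t ht => ?_)
      exact_mod_cast Nat.find_min' h ht
    have h2 : ∀ t, ENNReal.ofReal (busy a t x) =
        if t ∈ Finset.range (Nat.find h) then 1 else 0 := by
      intro t
      by_cases ht : t < Nat.find h
      · simp [busy, Nat.find_min h ht, ht]
      · simp [busy, (Nat.find_spec h).mono (not_lt.1 ht), ht]
    simp_rw [h1, h2]
    rw [tsum_eq_sum (s := Finset.range (Nat.find h)) (by intro b hb; simp [hb])]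
    rw [Finset.sum_congr rfl fun t ht => if_pos ht]
    simp
  · push Not at h
    have h1 : completionTime a (pattern x) = ⊤ := by simp [completionTime, h]
    simp [h1, busy, h]

end Network

end ParallelRouting

namespace ParallelRouting

variable {k ℓ : ℕ}

/-! ### The canonical law of the erasures -/

section ErasureMeasure

/-- The law of the independent erasures with probabilities `p i j`. -/
noncomputable def erasureMeasure (p : Fin k → Fin ℓ → ℝ) : Measure (ℕ × Fin k × Fin ℓ → Bool) :=
  bitsMeasure fun e => p e.2.1 e.2.2

variable {p : Fin k → Fin ℓ → ℝ}

lemma isProbabilityMeasure_erasureMeasure (hp0 : ∀ i j, 0 ≤ p i j) (hp1 : ∀ i j, p i j ≤ 1) :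
    IsProbabilityMeasure (erasureMeasure p) :=
  isProbabilityMeasure_bitsMeasure (fun _ => hp0 _ _) (fun _ => hp1 _ _)

lemma integrable_erasureMeasure (hp0 : ∀ i j, 0 ≤ p i j) (hp1 : ∀ i j, p i j ≤ 1)
    {G : (ℕ × Fin k × Fin ℓ → Bool) → ℝ} {S : Finset (ℕ × Fin k × Fin ℓ)}
    (hG : DependsOn G (S : Set (ℕ × Fin k × Fin ℓ))) : Integrable G (erasureMeasure p) :=
  integrable_of_dependsOn (fun _ => hp0 _ _) (fun _ => hp1 _ _) hG

lemma integral_link_mul (hp0 : ∀ i j, 0 ≤ p i j) (hp1 : ∀ i j, p i j ≤ 1) (φ : Bool → ℝ)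
    {t : ℕ} {i : Fin k} {j : Fin ℓ}
    {G : (ℕ × Fin k × Fin ℓ → Bool) → ℝ} {S : Finset (ℕ × Fin k × Fin ℓ)}
    (hG : DependsOn G (S : Set (ℕ × Fin k × Fin ℓ))) (he : (t, i, j) ∉ S) :
    ∫ x, φ (x (t, i, j)) * G x ∂erasureMeasure p
      = (p i j * φ true + (1 - p i j) * φ false) * ∫ x, G x ∂erasureMeasure p :=
  integral_comp_eval_mul (fun _ => hp0 _ _) (fun _ => hp1 _ _) φ hG he

end ErasureMeasure

/-! ### Upper bound: exponential potential -/

section Potential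

/-- The exponential potential of the packets that node `v` of path `i` still lacks. -/
noncomputable def potential (z : ℝ) (a : ℕ) (i : Fin k) (t : ℕ) (v : Fin (ℓ + 1))
    (x : ℕ × Fin k × Fin ℓ → Bool) : ℝ :=
  z ^ (a - received a (fun s j => pattern x s i j) t v) - 1

lemma dependsOn_potential (z : ℝ) (a : ℕ) (i : Fin k) (t : ℕ) (v : Fin (ℓ + 1)) :
    DependsOn (potential z a i t v) (before k ℓ t : Set (ℕ × Fin k × Fin ℓ)) := fun x y h => by
  unfold potential
  rw [show received _ _ _ = _ from dependsOn_received a t i h]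

lemma potential_castSucc_le_succ {z : ℝ} (hz : 1 ≤ z) (a : ℕ) (i : Fin k) (t : ℕ) (j : Fin ℓ)
    (x : ℕ × Fin k × Fin ℓ → Bool) :
    potential z a i t j.castSucc x ≤ potential z a i t j.succ x :=
  sub_le_sub_right
    (pow_le_pow_right₀ hz (Nat.sub_le_sub_left (received_succ_le_castSucc _ _ _ _) _)) _

lemma potential_nonneg {z : ℝ} (hz : 1 ≤ z) (a : ℕ) (i : Fin k) (t : ℕ) (v : Fin (ℓ + 1))
    (x : ℕ × Fin k × Fin ℓ → Bool) : 0 ≤ potential z a i t v x :=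
  sub_nonneg.2 (one_le_pow₀ hz)

/-- The difference of the two potentials vanishes when the buffer before link `j` is empty. It can
therefore replace the nonlinear buffer condition, and what remains is linear in the potentials. -/
lemma potential_succ_le {z : ℝ} (hz : 1 < z) (a : ℕ) (i : Fin k) (t : ℕ) (j : Fin ℓ)
    (x : ℕ × Fin k × Fin ℓ → Bool) :
    potential z a i (t + 1) j.succ x ≤ potential z a i t j.succ x -
      (if x (t, i, j) = false then 1 - 1 / z else 0) *
        (potential z a i t j.succ x - potential z a i t j.castSucc x) := by
  have hz0 : 0 < z := by linarith
  unfold potential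
  rw [received_succ_succ, show pattern x t i j = x (t, i, j) from rfl]
  generalize hR : received a (fun s j => pattern x s i j) t = R
  have hle : R j.succ ≤ R j.castSucc := by
    rw [← hR]; exact received_succ_le_castSucc _ _ _ _
  have hla : R j.castSucc ≤ a := by rw [← hR]; exact received_le _ _ _ _
  by_cases hx : x (t, i, j) = false
  · rcases hle.lt_or_eq with h | h
    · obtain ⟨m, hm⟩ : ∃ m, a - R j.succ = m + 1 := ⟨a - R j.succ - 1, by omega⟩
      have hm' : a - (R j.succ + 1) = m := by omega
      simp only [hx, h, and_self, if_true, hm, hm']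
      have : 0 ≤ (1 - 1 / z) * z ^ (a - R j.castSucc) := by
        have : 1 / z ≤ 1 := by rw [div_le_one hz0]; exact hz.le
        exact mul_nonneg (by linarith) (by positivity)
      have h2 : (1 - 1 / z) * z ^ (m + 1) = z ^ (m + 1) - z ^ m := by
        field_simp
        ring
      nlinarith
    · simp [h]
  · simp [hx]

variable {p : Fin k → Fin ℓ → ℝ}

lemma integral_potential_succ_le (hp0 : ∀ i j, 0 ≤ p i j) (hp1 : ∀ i j, p i j ≤ 1)
    {z s : ℝ} (hz : 1 < z) {i : Fin k} (hs : ∀ j, s ≤ 1 - p i j) (a t : ℕ) (j : Fin ℓ) :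
    ∫ x, potential z a i (t + 1) j.succ x ∂erasureMeasure p ≤
      (1 - s * (1 - 1 / z)) * ∫ x, potential z a i t j.succ x ∂erasureMeasure p +
        s * (1 - 1 / z) * ∫ x, potential z a i t j.castSucc x ∂erasureMeasure p := by
  have hz1 : 1 / z < 1 := by rw [div_lt_one (by linarith)]; exact hz
  have hint : ∀ t v, Integrable (potential z a i t v) (erasureMeasure p) := fun t v =>
    integrable_erasureMeasure hp0 hp1 (dependsOn_potential z a i t v)
  have hdep : DependsOn (fun x => potential z a i t j.succ x - potential z a i t j.castSucc x)
      (before k ℓ t : Set (ℕ × Fin k × Fin ℓ)) := fun x y h => by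
    simp only [show potential z a i t j.succ x = _ from dependsOn_potential _ _ _ _ _ h,
      show potential z a i t j.castSucc x = _ from dependsOn_potential _ _ _ _ _ h]
  have h1 := integral_link_mul hp0 hp1 (fun b => if b = false then 1 - 1 / z else 0)
    (t := t) (i := i) (j := j) hdep (by simp)
  have hdep2 : DependsOn (fun x : ℕ × Fin k × Fin ℓ → Bool =>
      (if x (t, i, j) = false then 1 - 1 / z else 0) *
      (potential z a i t j.succ x - potential z a i t j.castSucc x))
      (before k ℓ (t + 1) : Set (ℕ × Fin k × Fin ℓ)) := fun x y h => by
    have h3 := hdep (fun e he => h e (by simp at he ⊢; omega))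
    simp only at h3 ⊢
    rw [h3, h (t, i, j) (by simp)]
  have hint2 := integrable_erasureMeasure hp0 hp1 hdep2
  have h2 := integral_mono (hint (t + 1) j.succ) ((hint t j.succ).sub hint2)
    (fun x => potential_succ_le hz a i t j x)
  rw [integral_sub' (hint t j.succ) hint2, h1,
    integral_sub (hint t j.succ) (hint t j.castSucc)] at h2
  have h4 := integral_mono (hint t j.castSucc) (hint t j.succ)
    (fun x => potential_castSucc_le_succ hz.le a i t j x)
  simp only [reduceCtorEq, if_false, if_true, mul_zero, zero_add] at h2
  have h5 : s * (1 - 1 / z) ≤ (1 - p i j) * (1 - 1 / z) :=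
    mul_le_mul_of_nonneg_right (hs j) (by linarith)
  nlinarith

/-- A bound geometric in `v` and `t` is a supersolution of the recursion: with `γ = s (1 - 1/z)`,
the factor per slot is `(1 - γ) + γ w = 1 - γ (1 - w)`. At the source the potential is zero, which
is why 1 is subtracted in its definition. -/
lemma integral_potential_le (hp0 : ∀ i j, 0 ≤ p i j) (hp1 : ∀ i j, p i j ≤ 1)
    {z w s : ℝ} (hz : 1 < z) (hw0 : 0 < w) (hw1 : w < 1) (hs0 : 0 < s) (hs1 : s ≤ 1) {i : Fin k}
    (hs : ∀ j, s ≤ 1 - p i j) (a t : ℕ) (v : Fin (ℓ + 1)) :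
    ∫ x, potential z a i t v x ∂erasureMeasure p ≤
      z ^ a * w⁻¹ ^ (v : ℕ) * (1 - s * (1 - 1 / z) * (1 - w)) ^ t := by
  have := isProbabilityMeasure_erasureMeasure hp0 hp1
  have hz0 : 0 < z := by linarith
  have hz1 : 1 / z < 1 := by rw [div_lt_one hz0]; exact hz
  have hz2 : 0 < 1 / z := by positivity
  have hγ0 : 0 < s * (1 - 1 / z) := mul_pos hs0 (by linarith)
  have hγ1 : 0 ≤ 1 - s * (1 - 1 / z) := by nlinarith
  have hκ : 0 ≤ 1 - s * (1 - 1 / z) * (1 - w) := by nlinarith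
  induction t generalizing v with
  | zero =>
    calc _ ≤ ∫ x, z ^ a ∂erasureMeasure p := by
          refine integral_mono (integrable_erasureMeasure hp0 hp1 (dependsOn_potential z a i 0 v))
            (integrable_const _) fun x => ?_
          have : z ^ (a - received a (fun s j => pattern x s i j) 0 v) ≤ z ^ a :=
            pow_le_pow_right₀ hz.le (Nat.sub_le _ _)
          simp only [potential]; linarith
      _ = z ^ a := by simp
      _ ≤ _ := by
        rw [pow_zero, mul_one]
        exact le_mul_of_one_le_right (by positivity) (one_le_pow₀ ((one_le_inv₀ hw0).2 hw1.le))
  | succ t ih =>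
    cases v using Fin.cases with
    | zero =>
      simp only [potential, received_source, Nat.sub_self, pow_zero, sub_self, integral_zero]
      positivity
    | succ j =>
      refine (integral_potential_succ_le hp0 hp1 hz hs a t j).trans ?_
      have h2 := mul_le_mul_of_nonneg_left (ih j.succ) hγ1
      have h3 := mul_le_mul_of_nonneg_left (ih j.castSucc) hγ0.le
      refine (add_le_add h2 h3).trans_eq ?_
      simp only [Fin.val_succ, Fin.val_castSucc, pow_succ]
      field_simp
      ring

/-- The probability that some packet has not been delivered before slot `t`. -/
noncomputable def busyProb (p : Fin k → Fin ℓ → ℝ) (a : Fin k → ℕ) (t : ℕ) : ℝ :=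
  ∫ x, busy a t x ∂erasureMeasure p

lemma busyProb_nonneg (a : Fin k → ℕ) (t : ℕ) : 0 ≤ busyProb p a t :=
  integral_nonneg fun x => busy_nonneg a t x

lemma busyProb_le_one (hp0 : ∀ i j, 0 ≤ p i j) (hp1 : ∀ i j, p i j ≤ 1) (a : Fin k → ℕ) (t : ℕ) :
    busyProb p a t ≤ 1 := by
  have := isProbabilityMeasure_erasureMeasure hp0 hp1
  calc busyProb p a t ≤ ∫ x, 1 ∂erasureMeasure p :=
        integral_mono (integrable_erasureMeasure hp0 hp1 (dependsOn_busy a t))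
          (integrable_const _) (busy_le_one a t)
    _ = 1 := by simp

lemma busy_le_sum_potential {z : ℝ} (hz : 1 < z) (a : Fin k → ℕ) (t : ℕ)
    (x : ℕ × Fin k × Fin ℓ → Bool) :
    busy a t x ≤ ∑ i, potential z (a i) i t (Fin.last ℓ) x / (z - 1) := by
  have h0 : ∀ i, 0 ≤ potential z (a i) i t (Fin.last ℓ) x / (z - 1) := fun i =>
    div_nonneg (potential_nonneg hz.le _ _ _ _ _) (by linarith)
  by_cases h : Delivered a (pattern x) t
  · rw [busy, if_pos h]
    exact Finset.sum_nonneg fun i _ => h0 i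
  · rw [busy, if_neg h]
    obtain ⟨i, hi⟩ := not_forall.1 h
    refine le_trans ?_ (Finset.single_le_sum (fun i _ => h0 i) (Finset.mem_univ i))
    rw [one_le_div (by linarith)]
    have h1 : 1 ≤ a i - received (a i) (fun s j => pattern x s i j) t (Fin.last ℓ) := by
      have := received_le (a i) (fun s j => pattern x s i j) t (Fin.last ℓ)
      omega
    exact sub_le_sub_right (le_self_pow₀ hz.le (by omega)) 1

/-- The choice `z = 1 + δ`, `w = δ / (1 + δ)` gives the rate `s i * δ / (1 + δ)²` per slot, against
an initial potential of at most `exp (δ * a i)`. -/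
lemma busyProb_le_exp (hp0 : ∀ i j, 0 ≤ p i j) (hp1 : ∀ i j, p i j ≤ 1)
    {δ σ : ℝ} (hδ : 0 < δ) (hσ : 0 < σ) {s : Fin k → ℝ} (hσs : ∀ i, σ ≤ s i) (hs1 : ∀ i, s i ≤ 1)
    (hs : ∀ i j, s i ≤ 1 - p i j) {a : Fin k → ℕ} {y : ℝ} (ha : ∀ i, a i ≤ s i * y) {t : ℕ}
    (ht : (1 + δ) ^ 2 * y ≤ t) :
    busyProb p a t ≤ k * ((δ / (1 + δ))⁻¹ ^ ℓ / δ) *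
      Real.exp (σ * δ / (1 + δ) ^ 2 * ((1 + δ) ^ 2 * y - t)) := by
  have hz : 1 < 1 + δ := by linarith
  have hw1 : δ / (1 + δ) < 1 := by rw [div_lt_one (by linarith)]; linarith
  calc busyProb p a t
      ≤ ∫ x, ∑ i, potential (1 + δ) (a i) i t (Fin.last ℓ) x / (1 + δ - 1) ∂erasureMeasure p := by
        refine integral_mono (integrable_erasureMeasure hp0 hp1 (dependsOn_busy a t))
          (integrable_finsetSum _ fun i _ => Integrable.div_const ?_ _)
          (busy_le_sum_potential hz a t)
        exact integrable_erasureMeasure hp0 hp1 (dependsOn_potential _ _ _ _ _)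
    _ = ∑ i, (∫ x, potential (1 + δ) (a i) i t (Fin.last ℓ) x ∂erasureMeasure p) / δ := by
        rw [integral_finsetSum _ fun i _ => Integrable.div_const
          (integrable_erasureMeasure hp0 hp1 (dependsOn_potential _ _ _ _ _)) _]
        simp only [integral_div, add_sub_cancel_left]
    _ ≤ ∑ i : Fin k, (δ / (1 + δ))⁻¹ ^ ℓ *
          Real.exp (σ * δ / (1 + δ) ^ 2 * ((1 + δ) ^ 2 * y - t)) / δ := by
        refine Finset.sum_le_sum fun i _ => div_le_div_of_nonneg_right ?_ hδ.le
        have hsi : 0 < s i := hσ.trans_le (hσs i)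
        refine (integral_potential_le hp0 hp1 hz (by positivity) hw1 hsi (hs1 i) (hs i) (a i) t
          (Fin.last ℓ)).trans ?_
        rw [Fin.val_last, mul_comm ((1 + δ) ^ a i), mul_assoc]
        refine mul_le_mul_of_nonneg_left ?_ (by positivity)
        have e1 : s i * (1 - 1 / (1 + δ)) * (1 - δ / (1 + δ)) = s i * δ / (1 + δ) ^ 2 := by
          field_simp
          ring
        rw [e1]
        have e2 : (1 + δ) ^ a i ≤ Real.exp (δ * a i) := by
          rw [mul_comm, Real.exp_nat_mul]
          refine pow_le_pow_left₀ (by linarith) ?_ _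
          linarith [Real.add_one_le_exp δ]
        have e3 : (1 - s i * δ / (1 + δ) ^ 2) ^ t ≤ Real.exp (-(s i * δ / (1 + δ) ^ 2 * t)) := by
          rw [← neg_mul, mul_comm _ (t : ℝ), Real.exp_nat_mul]
          refine pow_le_pow_left₀ ?_ ?_ _
          · rw [sub_nonneg, div_le_one (by positivity)]
            nlinarith [hs1 i]
          · linarith [Real.add_one_le_exp (-(s i * δ / (1 + δ) ^ 2))]
        refine (mul_le_mul e2 e3 ?_ (Real.exp_nonneg _)).trans ?_
        · refine pow_nonneg ?_ _
          rw [sub_nonneg, div_le_one (by positivity)]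
          nlinarith [hs1 i]
        rw [← Real.exp_add, Real.exp_le_exp]
        have e4 : δ * a i ≤ δ * (s i * y) := mul_le_mul_of_nonneg_left (ha i) hδ.le
        have e5 : s i * δ / (1 + δ) ^ 2 * ((1 + δ) ^ 2 * y - t) =
            δ * (s i * y) - s i * δ / (1 + δ) ^ 2 * t := by
          field_simp
        -- The last factor is nonpositive by `ht`, so the smallest rate `σ` is the worst case.
        have e6 : s i * δ / (1 + δ) ^ 2 * ((1 + δ) ^ 2 * y - t) ≤
            σ * δ / (1 + δ) ^ 2 * ((1 + δ) ^ 2 * y - t) := by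
          refine mul_le_mul_of_nonpos_right ?_ (by linarith)
          gcongr
          exact hσs i
        linarith
    _ = _ := by simp; ring

/-- The expected completion time is at most `(1 + δ)² y` up to a constant, if the load of every
path is at most `y` times the capacity of the path. -/
lemma exists_tsum_busyProb_le (hp0 : ∀ i j, 0 ≤ p i j) (hp1 : ∀ i j, p i j ≤ 1)
    {δ σ : ℝ} (hδ : 0 < δ) (hσ : 0 < σ) {s : Fin k → ℝ} (hσs : ∀ i, σ ≤ s i) (hs1 : ∀ i, s i ≤ 1)
    (hs : ∀ i j, s i ≤ 1 - p i j) :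
    ∃ K : ℝ, ∀ (a : Fin k → ℕ) (y : ℝ), 0 ≤ y → (∀ i, a i ≤ s i * y) →
      Summable (busyProb p a) ∧ ∑' t, busyProb p a t ≤ (1 + δ) ^ 2 * y + K := by
  set κ := σ * δ / (1 + δ) ^ 2 with hκ
  have hκ0 : 0 < κ := by positivity
  set K := k * ((δ / (1 + δ))⁻¹ ^ ℓ / δ) with hK
  have hK0 : 0 ≤ K := by positivity
  have hgeo : Summable fun t : ℕ => K * Real.exp (-κ) ^ t :=
    (summable_geometric_of_lt_one (Real.exp_nonneg _) (by
      rw [Real.exp_lt_one_iff]; linarith)).mul_left K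
  refine ⟨1 + ∑' t : ℕ, K * Real.exp (-κ) ^ t, fun a y hy ha => ?_⟩
  -- Before `N` each term is at most 1; after `N` a geometric series independent of `a` and `y`
  -- dominates.
  set N := ⌈(1 + δ) ^ 2 * y⌉₊ with hN
  have htail : ∀ t, busyProb p a (t + N) ≤ K * Real.exp (-κ) ^ t := fun t => by
    have h1 : (1 + δ) ^ 2 * y ≤ N := Nat.le_ceil _
    have h2 : (1 + δ) ^ 2 * y ≤ (t + N : ℕ) := by
      push_cast; linarith [(Nat.cast_nonneg t : (0:ℝ) ≤ t)]
    refine (busyProb_le_exp hp0 hp1 hδ hσ hσs hs1 hs ha h2).trans ?_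
    refine mul_le_mul_of_nonneg_left ?_ hK0
    rw [← Real.exp_nat_mul, Real.exp_le_exp, ← hκ]
    push_cast
    nlinarith
  have hsum : Summable fun t => busyProb p a (t + N) :=
    Summable.of_nonneg_of_le (fun t => busyProb_nonneg a _) htail hgeo
  have hsum' : Summable (busyProb p a) := (summable_nat_add_iff N).1 hsum
  refine ⟨hsum', ?_⟩
  rw [← hsum'.sum_add_tsum_nat_add N]
  have h1 : ∑ t ∈ Finset.range N, busyProb p a t ≤ N := by
    simpa using Finset.sum_le_card_nsmul (Finset.range N) _ 1 fun t _ => busyProb_le_one hp0 hp1 a t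
  have h2 := hsum.tsum_le_tsum htail hgeo
  have h3 : (N : ℝ) < (1 + δ) ^ 2 * y + 1 := Nat.ceil_lt_add_one (by positivity)
  linarith

end Potential

end ParallelRouting

namespace ParallelRouting

variable {k ℓ : ℕ} {p : Fin k → Fin ℓ → ℝ}

/-! ### Moments of a centred walk on one link -/

section Walk

/-- The random walk whose steps are a function `φ` of the states of one link. -/
noncomputable def linkWalk (φ : Bool → ℝ) (i : Fin k) (j : Fin ℓ) (m : ℕ)
    (x : ℕ × Fin k × Fin ℓ → Bool) : ℝ :=
  ∑ t ∈ Finset.range m, φ (x (t, i, j))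

/-- The labels of one link in the slots before `m`. -/
def linkBefore (i : Fin k) (j : Fin ℓ) (m : ℕ) : Finset (ℕ × Fin k × Fin ℓ) :=
  Finset.range m ×ˢ {(i, j)}

@[simp] lemma mem_linkBefore {i : Fin k} {j : Fin ℓ} {m : ℕ} {e : ℕ × Fin k × Fin ℓ} :
    e ∈ linkBefore i j m ↔ e.1 < m ∧ e.2 = (i, j) := by
  simp only [linkBefore, Finset.mem_product, Finset.mem_range, Finset.mem_singleton]

lemma dependsOn_linkWalk (φ : Bool → ℝ) (i : Fin k) (j : Fin ℓ) (m : ℕ) :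
    DependsOn (linkWalk φ i j m) (linkBefore i j m : Set (ℕ × Fin k × Fin ℓ)) := fun x y h => by
  refine Finset.sum_congr rfl fun t ht => ?_
  rw [h (t, i, j) (by simpa using ht)]

lemma dependsOn_linkWalk_comp {β : Type*} (g : ℝ → β) (φ : Bool → ℝ) (i : Fin k) (j : Fin ℓ)
    (m : ℕ) : DependsOn (fun x => g (linkWalk φ i j m x))
      (linkBefore i j m : Set (ℕ × Fin k × Fin ℓ)) := fun x y h => by
  simp only [dependsOn_linkWalk φ i j m h]

lemma integral_step_mul (hp0 : ∀ i j, 0 ≤ p i j) (hp1 : ∀ i j, p i j ≤ 1) (f : Bool → ℝ)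
    (g : ℝ → ℝ) (φ : Bool → ℝ) (i : Fin k) (j : Fin ℓ) (m : ℕ) :
    ∫ x, f (x (m, i, j)) * g (linkWalk φ i j m x) ∂erasureMeasure p
      = (p i j * f true + (1 - p i j) * f false) *
        ∫ x, g (linkWalk φ i j m x) ∂erasureMeasure p :=
  integral_link_mul hp0 hp1 f (dependsOn_linkWalk_comp g φ i j m) (by simp)

lemma integrable_step_mul (hp0 : ∀ i j, 0 ≤ p i j) (hp1 : ∀ i j, p i j ≤ 1) (f : Bool → ℝ)
    (g : ℝ → ℝ) (φ : Bool → ℝ) (i : Fin k) (j : Fin ℓ) (m : ℕ) :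
    Integrable (fun x => f (x (m, i, j)) * g (linkWalk φ i j m x)) (erasureMeasure p) := by
  refine integrable_erasureMeasure hp0 hp1 (S := linkBefore i j (m + 1)) fun x y h => ?_
  have h1 := dependsOn_linkWalk φ i j m (fun e he => h e (by simp at he ⊢; exact ⟨by omega, he.2⟩))
  simp only [h1, h (m, i, j) (by simp)]

variable {φ : Bool → ℝ} {i : Fin k} {j : Fin ℓ}

lemma integral_linkWalk (hp0 : ∀ i j, 0 ≤ p i j) (hp1 : ∀ i j, p i j ≤ 1)
    (hφ : p i j * φ true + (1 - p i j) * φ false = 0) (m : ℕ) :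
    ∫ x, linkWalk φ i j m x ∂erasureMeasure p = 0 := by
  induction m with
  | zero => simp [linkWalk]
  | succ m ih =>
    have h1 := integral_step_mul hp0 hp1 φ (fun _ => 1) φ i j m
    have i1 := integrable_step_mul hp0 hp1 φ (fun _ => 1) φ i j m
    have i2 := integrable_step_mul hp0 hp1 (fun _ => 1) (fun y => y) φ i j m
    simp only [mul_one, one_mul] at h1 i1 i2
    have e : ∀ x, linkWalk φ i j (m + 1) x = linkWalk φ i j m x + φ (x (m, i, j)) := fun x => by
      simp only [linkWalk, Finset.sum_range_succ]
    simp_rw [e]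
    rw [integral_add i2 i1, ih, h1, hφ]
    simp

lemma integral_linkWalk_sq (hp0 : ∀ i j, 0 ≤ p i j) (hp1 : ∀ i j, p i j ≤ 1)
    (hφ : p i j * φ true + (1 - p i j) * φ false = 0) (m : ℕ) :
    ∫ x, linkWalk φ i j m x ^ 2 ∂erasureMeasure p =
      m * (p i j * φ true ^ 2 + (1 - p i j) * φ false ^ 2) := by
  have := isProbabilityMeasure_erasureMeasure hp0 hp1
  induction m with
  | zero => simp [linkWalk]
  | succ m ih =>
    have h1 := integral_step_mul hp0 hp1 (fun b => 2 * φ b) (fun y => y) φ i j m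
    have i1 := integrable_step_mul hp0 hp1 (fun b => 2 * φ b) (fun y => y) φ i j m
    have h2 := integral_step_mul hp0 hp1 (fun b => φ b ^ 2) (fun _ => 1) φ i j m
    have i2 := integrable_step_mul hp0 hp1 (fun b => φ b ^ 2) (fun _ => 1) φ i j m
    have i3 := integrable_step_mul hp0 hp1 (fun _ => 1) (fun y => y ^ 2) φ i j m
    rw [integral_linkWalk hp0 hp1 hφ] at h1
    simp only [mul_one, one_mul, integral_const, probReal_univ, smul_eq_mul] at h1 h2 i2 i3
    have e : ∀ x, linkWalk φ i j (m + 1) x ^ 2 = linkWalk φ i j m x ^ 2 +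
        (2 * φ (x (m, i, j)) * linkWalk φ i j m x + φ (x (m, i, j)) ^ 2) := fun x => by
      simp only [linkWalk, Finset.sum_range_succ]; ring
    simp_rw [e]
    rw [integral_add i3 (i1.fun_add i2), integral_add i1 i2, ih, h1, h2]
    push_cast
    ring

/-- The terms with an odd power of the walk have mean zero. With step variance `v` and fourth moment
`u`, the increment is `6 m v² + u ≤ ((m + 1)² - m²)(3 v² + u)`. -/
lemma integral_linkWalk_pow_four_le (hp0 : ∀ i j, 0 ≤ p i j) (hp1 : ∀ i j, p i j ≤ 1)
    (hφ : p i j * φ true + (1 - p i j) * φ false = 0) (m : ℕ) :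
    ∫ x, linkWalk φ i j m x ^ 4 ∂erasureMeasure p ≤
      m ^ 2 * (3 * (p i j * φ true ^ 2 + (1 - p i j) * φ false ^ 2) ^ 2 +
        (p i j * φ true ^ 4 + (1 - p i j) * φ false ^ 4)) := by
  have := isProbabilityMeasure_erasureMeasure hp0 hp1
  have hu : 0 ≤ p i j * φ true ^ 4 + (1 - p i j) * φ false ^ 4 :=
    add_nonneg (mul_nonneg (hp0 _ _) (by positivity))
      (mul_nonneg (by linarith [hp1 i j]) (by positivity))
  induction m with
  | zero => simp [linkWalk]
  | succ m ih =>
    have h1 := integral_step_mul hp0 hp1 (fun b => 4 * φ b) (fun y => y ^ 3) φ i j m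
    have i1 := integrable_step_mul hp0 hp1 (fun b => 4 * φ b) (fun y => y ^ 3) φ i j m
    have h2 := integral_step_mul hp0 hp1 (fun b => 6 * φ b ^ 2) (fun y => y ^ 2) φ i j m
    have i2 := integrable_step_mul hp0 hp1 (fun b => 6 * φ b ^ 2) (fun y => y ^ 2) φ i j m
    have h3 := integral_step_mul hp0 hp1 (fun b => 4 * φ b ^ 3) (fun y => y) φ i j m
    have i3 := integrable_step_mul hp0 hp1 (fun b => 4 * φ b ^ 3) (fun y => y) φ i j m
    have h4 := integral_step_mul hp0 hp1 (fun b => φ b ^ 4) (fun _ => 1) φ i j m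
    have i4 := integrable_step_mul hp0 hp1 (fun b => φ b ^ 4) (fun _ => 1) φ i j m
    have i5 := integrable_step_mul hp0 hp1 (fun _ => 1) (fun y => y ^ 4) φ i j m
    rw [integral_linkWalk hp0 hp1 hφ] at h3
    rw [integral_linkWalk_sq hp0 hp1 hφ] at h2
    have h1' : p i j * (4 * φ true) + (1 - p i j) * (4 * φ false) = 0 := by
      linear_combination 4 * hφ
    rw [h1', zero_mul] at h1
    simp only [mul_one, one_mul, integral_const, probReal_univ, smul_eq_mul] at h4 i4 i5
    have e : ∀ x, linkWalk φ i j (m + 1) x ^ 4 = linkWalk φ i j m x ^ 4 +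
        (4 * φ (x (m, i, j)) * linkWalk φ i j m x ^ 3 +
        (6 * φ (x (m, i, j)) ^ 2 * linkWalk φ i j m x ^ 2 +
        (4 * φ (x (m, i, j)) ^ 3 * linkWalk φ i j m x + φ (x (m, i, j)) ^ 4))) := fun x => by
      simp only [linkWalk, Finset.sum_range_succ]; ring
    simp_rw [e]
    rw [integral_add i5 (i1.fun_add (i2.fun_add (i3.fun_add i4))),
      integral_add i1 (i2.fun_add (i3.fun_add i4)),
      integral_add i2 (i3.fun_add i4), integral_add i3 i4, h1, h2, h3, h4]
    push_cast
    nlinarith [(Nat.cast_nonneg m : (0 : ℝ) ≤ m),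
      sq_nonneg (p i j * φ true ^ 2 + (1 - p i j) * φ false ^ 2),
      mul_nonneg (Nat.cast_nonneg m : (0 : ℝ) ≤ m) hu]

/-- After scaling by `r` this is `u² - u⁴ ≤ u` for `u ≥ 0`. It turns second and fourth moments into
a lower bound for the first absolute moment. -/
lemma sub_le_abs {y r : ℝ} (hr : 0 < r) : y ^ 2 / r - y ^ 4 / r ^ 3 ≤ |y| := by
  obtain ⟨u, hu⟩ : ∃ u, |y| = r * u := ⟨|y| / r, by field_simp⟩
  have hu0 : 0 ≤ u := by
    by_contra! h
    nlinarith [abs_nonneg y]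
  have h2 : y ^ 2 / r = r * u ^ 2 := by rw [← sq_abs, hu]; field_simp
  have h4 : y ^ 4 / r ^ 3 = r * u ^ 4 := by
    rw [show y ^ 4 = (y ^ 2) ^ 2 by ring, ← sq_abs y, hu]; field_simp
  rw [h2, h4, hu, ← mul_sub]
  refine mul_le_mul_of_nonneg_left ?_ hr.le
  rcases le_total u 1 with h | h
  · nlinarith [pow_nonneg hu0 4]
  · nlinarith [mul_nonneg (sq_nonneg u) (show 0 ≤ u ^ 2 - 1 by nlinarith)]

lemma exists_sqrt_le_integral_abs_linkWalk (hp0 : ∀ i j, 0 ≤ p i j) (hp1 : ∀ i j, p i j ≤ 1)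
    (hφ : p i j * φ true + (1 - p i j) * φ false = 0)
    (hv : 0 < p i j * φ true ^ 2 + (1 - p i j) * φ false ^ 2) :
    ∃ c : ℝ, 0 < c ∧ ∀ m : ℕ, c * √(m : ℝ) ≤ ∫ x, |linkWalk φ i j m x| ∂erasureMeasure p := by
  set v := p i j * φ true ^ 2 + (1 - p i j) * φ false ^ 2 with hvdef
  set w := 3 * v ^ 2 + (p i j * φ true ^ 4 + (1 - p i j) * φ false ^ 4) with hw
  have hw0 : 0 < w := by
    have : 0 ≤ p i j * φ true ^ 4 + (1 - p i j) * φ false ^ 4 :=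
      add_nonneg (mul_nonneg (hp0 _ _) (by positivity))
        (mul_nonneg (by linarith [hp1 i j]) (by positivity))
    positivity
  -- At `r = L √m` the moment bounds give `√m (v / L - w / L³)`; this `L` makes the second term half
  -- of the first.
  set L := √(2 * w / v) with hL
  have hL0 : 0 < L := Real.sqrt_pos.2 (by positivity)
  have hL2 : L ^ 2 = 2 * w / v := Real.sq_sqrt (by positivity)
  refine ⟨v / (2 * L), by positivity, fun m => ?_⟩
  rcases Nat.eq_zero_or_pos m with rfl | hm
  · simpa using integral_nonneg fun x => abs_nonneg _
  have hm0 : (0 : ℝ) < m := by exact_mod_cast hm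
  have hq : 0 < √(m : ℝ) := Real.sqrt_pos.2 hm0
  have hq2 : √(m : ℝ) ^ 2 = m := Real.sq_sqrt hm0.le
  have hint : ∀ g : ℝ → ℝ, Integrable (fun x => g (linkWalk φ i j m x)) (erasureMeasure p) :=
    fun g => integrable_erasureMeasure hp0 hp1 (dependsOn_linkWalk_comp g φ i j m)
  have hr : 0 < L * √(m : ℝ) := by positivity
  have h1 := integral_mono ((hint fun y => y ^ 2 / (L * √(m : ℝ))).sub
    (hint fun y => y ^ 4 / (L * √(m : ℝ)) ^ 3)) (hint fun y => |y|) fun x => sub_le_abs hr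
  rw [integral_sub' (hint fun y => y ^ 2 / (L * √(m : ℝ)))
    (hint fun y => y ^ 4 / (L * √(m : ℝ)) ^ 3), integral_div, integral_div,
    integral_linkWalk_sq hp0 hp1 hφ, ← hvdef] at h1
  refine le_trans ?_ h1
  have h4 := div_le_div_of_nonneg_right (integral_linkWalk_pow_four_le hp0 hp1 hφ m)
    (show 0 ≤ (L * √(m : ℝ)) ^ 3 by positivity)
  rw [← hvdef, ← hw] at h4
  refine le_trans ?_ (sub_le_sub_left h4 _)
  have hwL : w = L ^ 2 * v / 2 := by rw [hL2]; field_simp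
  rw [← hq2, hwL]
  apply le_of_eq
  field_simp
  rw [Real.sqrt_sq hq.le]
  ring

end Walk

/-! ### Lower bound: two competing paths -/

section Lower

/-- The centred and normalized indicator of a successful transmission over a link that works with
probability `s`. -/
noncomputable def centredSuccess (s : ℝ) (b : Bool) : ℝ := (if b = false then 1 / s else 0) - 1

/-- Up to completion, link `j` must succeed at least `a i` times, and `1 + centredSuccess s` is a
success divided by `s`. The factor `1 - busy` discards the outcomes that are unfinished at the
horizon `N`, which keeps all sums finite. -/
lemma div_mul_one_sub_busy_le {a : Fin k → ℕ} {s : ℝ} (hs : 0 < s) (i : Fin k) (j : Fin ℓ) (N : ℕ)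
    (x : ℕ × Fin k × Fin ℓ → Bool) :
    a i / s * (1 - busy a N x) ≤
      ∑ t ∈ Finset.range N, busy a t x * (1 + centredSuccess s (x (t, i, j))) := by
  have h0 : ∀ t, 0 ≤ busy a t x * (1 + centredSuccess s (x (t, i, j))) := fun t =>
    mul_nonneg (busy_nonneg a t x) (by
      unfold centredSuccess; split_ifs <;> simp; positivity)
  by_cases h : Delivered a (pattern x) N
  · classical
    have hex : ∃ t, Delivered a (pattern x) t := ⟨N, h⟩
    set T := Nat.find hex with hT
    have hTN : T ≤ N := Nat.find_min' hex h
    have hTd : Delivered a (pattern x) T := Nat.find_spec hex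
    have h1 : (a i : ℝ) ≤ ∑ t ∈ Finset.range T, if x (t, i, j) = false then (1 : ℝ) else 0 := by
      have := received_last_le_sum (a i) (fun s j => pattern x s i j) T j
      rw [hTd i] at this
      exact_mod_cast this
    rw [busy, if_pos h, sub_zero, mul_one]
    calc a i / s ≤ (∑ t ∈ Finset.range T, if x (t, i, j) = false then (1 : ℝ) else 0) / s :=
          div_le_div_of_nonneg_right h1 hs.le
      _ = ∑ t ∈ Finset.range T, busy a t x * (1 + centredSuccess s (x (t, i, j))) := by
          rw [Finset.sum_div]
          refine Finset.sum_congr rfl fun t ht => ?_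
          rw [busy, if_neg (Nat.find_min hex (Finset.mem_range.1 ht)), one_mul, centredSuccess]
          split_ifs <;> simp
      _ ≤ _ := Finset.sum_le_sum_of_subset_of_nonneg (Finset.range_mono hTN) fun t _ _ => h0 t
  · rw [busy, if_neg h, sub_self, mul_zero]
    exact Finset.sum_nonneg fun t _ => h0 t

open Classical in
/-- The indicator of the event that the walk of centred successes is below its mean. -/
noncomputable def lagging (s : ℝ) (i : Fin k) (j : Fin ℓ) (m : ℕ)
    (x : ℕ × Fin k × Fin ℓ → Bool) : ℝ :=
  if linkWalk (centredSuccess s) i j m x < 0 then 1 else 0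

lemma dependsOn_lagging (s : ℝ) (i : Fin k) (j : Fin ℓ) (m : ℕ) :
    DependsOn (lagging s i j m) (linkBefore i j m : Set (ℕ × Fin k × Fin ℓ)) :=
  dependsOn_linkWalk_comp (fun y => if y < 0 then 1 else 0) _ _ _ _

lemma lagging_nonneg (s : ℝ) (i : Fin k) (j : Fin ℓ) (m : ℕ) (x : ℕ × Fin k × Fin ℓ → Bool) :
    0 ≤ lagging s i j m x := by
  unfold lagging; split_ifs <;> simp

lemma lagging_le_one (s : ℝ) (i : Fin k) (j : Fin ℓ) (m : ℕ) (x : ℕ × Fin k × Fin ℓ → Bool) :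
    lagging s i j m x ≤ 1 := by
  unfold lagging; split_ifs <;> simp

lemma lagging_mul_linkWalk (s : ℝ) (i : Fin k) (j : Fin ℓ) (m : ℕ)
    (x : ℕ × Fin k × Fin ℓ → Bool) :
    lagging s i j m x * linkWalk (centredSuccess s) i j m x =
      (linkWalk (centredSuccess s) i j m x - |linkWalk (centredSuccess s) i j m x|) / 2 := by
  unfold lagging
  split_ifs with h
  · rw [abs_of_neg h]; ring
  · rw [abs_of_nonneg (not_lt.1 h)]; ring

lemma mean_centredSuccess {q : ℝ} (hq : q < 1) :
    q * centredSuccess (1 - q) true + (1 - q) * centredSuccess (1 - q) false = 0 := by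
  have : 1 - q ≠ 0 := by linarith
  simp [centredSuccess]
  field_simp
  ring

lemma integral_centredSuccess_mul (hp0 : ∀ i j, 0 ≤ p i j) (hp1 : ∀ i j, p i j < 1)
    {t : ℕ} {i : Fin k} {j : Fin ℓ}
    {G : (ℕ × Fin k × Fin ℓ → Bool) → ℝ} {S : Finset (ℕ × Fin k × Fin ℓ)}
    (hG : DependsOn G (S : Set (ℕ × Fin k × Fin ℓ))) (he : (t, i, j) ∉ S) :
    ∫ x, centredSuccess (1 - p i j) (x (t, i, j)) * G x ∂erasureMeasure p = 0 := by
  rw [integral_link_mul hp0 (fun i j => (hp1 i j).le) _ hG he, mean_centredSuccess (hp1 i j),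
    zero_mul]

/-- Wald's identity, with the path chosen by the event `A` that path `i₁` lags after `a i₁` slots.
`U₁` and `U₂` are the centred increments on `A` and on its complement; only `U₁` in the first `a i₁`
slots has a nonzero total mean. -/
lemma le_sum_busyProb (hℓ : 1 ≤ ℓ) (hp0 : ∀ i j, 0 ≤ p i j) (hp1 : ∀ i j, p i j < 1)
    {i₁ i₂ : Fin k} (hi : i₁ ≠ i₂) (j₁ j₂ : Fin ℓ) {a : Fin k → ℕ} {y : ℝ}
    (hy₁ : y ≤ a i₁ / (1 - p i₁ j₁)) (hy₂ : y ≤ a i₂ / (1 - p i₂ j₂)) {N : ℕ} (hN : a i₁ ≤ N) :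
    y - (a i₁ / (1 - p i₁ j₁) + a i₂ / (1 - p i₂ j₂)) * busyProb p a N +
      (∫ x, |linkWalk (centredSuccess (1 - p i₁ j₁)) i₁ j₁ (a i₁) x| ∂erasureMeasure p) / 2 ≤
    ∑ t ∈ Finset.range N, busyProb p a t := by
  have hp1' : ∀ i j, p i j ≤ 1 := fun i j => (hp1 i j).le
  have := isProbabilityMeasure_erasureMeasure hp0 hp1'
  set s₁ := 1 - p i₁ j₁ with hs₁
  set s₂ := 1 - p i₂ j₂ with hs₂
  have hs₁0 : 0 < s₁ := by linarith [hp1 i₁ j₁]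
  have hs₂0 : 0 < s₂ := by linarith [hp1 i₂ j₂]
  set m := a i₁ with hm
  set A := lagging s₁ i₁ j₁ m with hA
  set U₁ : ℕ → (ℕ × Fin k × Fin ℓ → Bool) → ℝ := fun t x =>
    centredSuccess s₁ (x (t, i₁, j₁)) * (A x * busy a t x) with hU₁
  set U₂ : ℕ → (ℕ × Fin k × Fin ℓ → Bool) → ℝ := fun t x =>
    centredSuccess s₂ (x (t, i₂, j₂)) * ((1 - A x) * busy a t x) with hU₂
  have hpt : ∀ x, y - (a i₁ / s₁ + a i₂ / s₂) * busy a N x ≤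
      ∑ t ∈ Finset.range N, (busy a t x + (U₁ t x + U₂ t x)) := by
    intro x
    have h1 := mul_le_mul_of_nonneg_left (div_mul_one_sub_busy_le (a := a) hs₁0 i₁ j₁ N x)
      (lagging_nonneg s₁ i₁ j₁ m x)
    have h2 := mul_le_mul_of_nonneg_left (div_mul_one_sub_busy_le (a := a) hs₂0 i₂ j₂ N x)
      (sub_nonneg.2 (lagging_le_one s₁ i₁ j₁ m x))
    have h3 : ∑ t ∈ Finset.range N, (busy a t x + (U₁ t x + U₂ t x)) =
        A x * ∑ t ∈ Finset.range N, busy a t x * (1 + centredSuccess s₁ (x (t, i₁, j₁))) +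
        (1 - A x) *
          ∑ t ∈ Finset.range N, busy a t x * (1 + centredSuccess s₂ (x (t, i₂, j₂))) := by
      rw [Finset.mul_sum, Finset.mul_sum, ← Finset.sum_add_distrib]
      refine Finset.sum_congr rfl fun t _ => ?_
      simp only [hU₁, hU₂]; ring
    rw [h3]
    refine le_trans ?_ (add_le_add h1 h2)
    rw [← hA]
    have hA0 : 0 ≤ A x := lagging_nonneg _ _ _ _ _
    have hA1 : A x ≤ 1 := lagging_le_one _ _ _ _ _
    have hB0 := busy_nonneg a N x
    have e1 : 0 ≤ (a i₁ : ℝ) / s₁ := by positivity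
    have e2 : 0 ≤ (a i₂ : ℝ) / s₂ := by positivity
    have e3 : y ≤ A x * (a i₁ / s₁) + (1 - A x) * (a i₂ / s₂) := by nlinarith
    have e4 : A x * (a i₁ / s₁) ≤ a i₁ / s₁ := mul_le_of_le_one_left e1 hA1
    have e5 : (1 - A x) * (a i₂ / s₂) ≤ a i₂ / s₂ := mul_le_of_le_one_left e2 (by linarith)
    nlinarith
  have hAdep : ∀ t, DependsOn A (before k ℓ (max t m) : Set (ℕ × Fin k × Fin ℓ)) := fun t =>
    (dependsOn_lagging s₁ i₁ j₁ m).mono fun e he => by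
      simp at he ⊢; exact Or.inr he.1
  have hBdep : ∀ t, DependsOn (busy a t) (before k ℓ (max t m) : Set (ℕ × Fin k × Fin ℓ)) :=
    fun t => (dependsOn_busy a t).mono fun e he => by
      simp at he ⊢; exact Or.inl he
  have hBint : ∀ t, Integrable (busy a t) (erasureMeasure p) := fun t =>
    integrable_erasureMeasure hp0 hp1' (dependsOn_busy a t)
  have hdep : ∀ (f : Bool → ℝ) (g : ℝ → ℝ → ℝ) (i : Fin k) (j : Fin ℓ) (t : ℕ),
      Integrable (fun x => f (x (t, i, j)) * g (A x) (busy a t x)) (erasureMeasure p) := by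
    intro f g i j t
    refine integrable_erasureMeasure hp0 hp1' (S := before k ℓ (max t m + 1)) fun x y h => ?_
    have h1 := hAdep t (fun e he => h e (by simp at he ⊢; omega))
    have h2 := hBdep t (fun e he => h e (by simp at he ⊢; omega))
    simp only [h1, h2, h (t, i, j) (by simp)]
  have hU₁int : ∀ t, Integrable (U₁ t) (erasureMeasure p) := fun t =>
    hdep (centredSuccess s₁) (fun u v => u * v) i₁ j₁ t
  have hU₂int : ∀ t, Integrable (U₂ t) (erasureMeasure p) := fun t =>
    hdep (centredSuccess s₂) (fun u v => (1 - u) * v) i₂ j₂ t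
  -- From slot `m` on, `A` belongs to the past, so the increment is centred given `A` and `busy`.
  have hU₁late : ∀ t, m ≤ t → ∫ x, U₁ t x ∂erasureMeasure p = 0 := fun t ht => by
    refine integral_centredSuccess_mul hp0 hp1 (S := before k ℓ t) (fun x y h => ?_) (by simp)
    simp only [hAdep t (fun e he => h e (by simpa [ht] using he)), dependsOn_busy a t h]
  have hU₂zero : ∀ t, ∫ x, U₂ t x ∂erasureMeasure p = 0 := fun t => by
    rcases le_or_gt m t with ht | ht
    · refine integral_centredSuccess_mul hp0 hp1 (S := before k ℓ t) (fun x y h => ?_) (by simp)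
      simp only [hAdep t (fun e he => h e (by simpa [ht] using he)), dependsOn_busy a t h]
    -- Here `A` looks into the future, but only at path `i₁ ≠ i₂`, and `busy` is constantly 1.
    · refine integral_centredSuccess_mul hp0 hp1 (S := linkBefore i₁ j₁ m) (fun x y h => ?_)
        (by simp [hi.symm])
      simp only [show A x = A y from dependsOn_lagging s₁ i₁ j₁ m h, busy_eq_one hℓ ht]
  have hU₁sum : ∑ t ∈ Finset.range N, ∫ x, U₁ t x ∂erasureMeasure p =
      -((∫ x, |linkWalk (centredSuccess s₁) i₁ j₁ m x| ∂erasureMeasure p) / 2) := by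
    rw [← Finset.sum_subset (Finset.range_mono hN) fun t _ ht => hU₁late t (by simpa using ht),
      ← integral_finsetSum _ fun t _ => hU₁int t]
    -- Before slot `m` nothing is stopped, so the sum is the negative part of the walk, with a minus
    -- sign.
    have e : ∀ x, ∑ t ∈ Finset.range m, U₁ t x =
        (linkWalk (centredSuccess s₁) i₁ j₁ m x -
          |linkWalk (centredSuccess s₁) i₁ j₁ m x|) / 2 := fun x => by
      rw [← lagging_mul_linkWalk, linkWalk, Finset.mul_sum]
      refine Finset.sum_congr rfl fun t ht => ?_
      simp only [hU₁, busy_eq_one hℓ (Finset.mem_range.1 ht)]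
      ring
    simp_rw [e]
    have hint : ∀ g : ℝ → ℝ, Integrable
        (fun x => g (linkWalk (centredSuccess s₁) i₁ j₁ m x)) (erasureMeasure p) :=
      fun g => integrable_erasureMeasure hp0 hp1' (dependsOn_linkWalk_comp g _ _ _ _)
    rw [integral_div, integral_sub (hint fun y => y) (hint fun y => |y|),
      integral_linkWalk hp0 hp1' (mean_centredSuccess (hp1 i₁ j₁))]
    ring
  have hfin := integral_mono (μ := erasureMeasure p)
    ((integrable_const y).sub ((hBint N).const_mul (a i₁ / s₁ + a i₂ / s₂)))
    (integrable_finsetSum _ fun t _ => (hBint t).fun_add ((hU₁int t).fun_add (hU₂int t))) hpt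
  rw [integral_sub' (integrable_const y) ((hBint N).const_mul (a i₁ / s₁ + a i₂ / s₂)),
    integral_const_mul,
    integral_finsetSum _ fun t _ => (hBint t).fun_add ((hU₁int t).fun_add (hU₂int t))] at hfin
  have e : ∀ t, ∫ x, busy a t x + (U₁ t x + U₂ t x) ∂erasureMeasure p =
      busyProb p a t + ∫ x, U₁ t x ∂erasureMeasure p := fun t => by
    rw [integral_add (hBint t) ((hU₁int t).fun_add (hU₂int t)), integral_add (hU₁int t) (hU₂int t),
      hU₂zero, add_zero]
    rfl
  simp only [e, Finset.sum_add_distrib, hU₁sum, integral_const, probReal_univ,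
    one_smul] at hfin
  change y - _ * busyProb p a N ≤ _ at hfin
  linarith

end Lower

end ParallelRouting

/-! ### Transfer to an arbitrary erasure process, and the theorem -/

namespace ParallelRouting

variable {k ℓ : ℕ} {p : Fin k → Fin ℓ → ℝ}

lemma IsErasureProcess.map_eq {Ω : Type*} [MeasurableSpace Ω] {P : Measure Ω}
    [IsProbabilityMeasure P] {X : ℕ → Fin k → Fin ℓ → Ω → Bool} (h : IsErasureProcess p P X) :
    P.map (fun ω (e : ℕ × Fin k × Fin ℓ) => X e.1 e.2.1 e.2.2 ω) = erasureMeasure p := by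
  rw [h.indep.map_fun_eq_infinitePi_map fun e => h.measurable _ _ _, erasureMeasure, bitsMeasure]
  congr 1
  funext e
  exact map_eq_bernoulliBit (h.measurable _ _ _) (h.prob _ _ _)

lemma IsErasureProcess.lintegral_completionTime (hp0 : ∀ i j, 0 ≤ p i j)
    (hp1 : ∀ i j, p i j ≤ 1) {Ω : Type*} [MeasurableSpace Ω] {P : Measure Ω}
    [IsProbabilityMeasure P] {X : ℕ → Fin k → Fin ℓ → Ω → Bool} (h : IsErasureProcess p P X)
    (a : Fin k → ℕ) :
    ∫⁻ ω, (completionTime a (fun t i j => X t i j ω) : ℝ≥0∞) ∂P =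
      ∑' t, ENNReal.ofReal (busyProb p a t) := by
  have hm : ∀ t, Measurable fun x : ℕ × Fin k × Fin ℓ → Bool => ENNReal.ofReal (busy a t x) :=
    fun t => (measurable_of_dependsOn (dependsOn_busy a t)).ennreal_ofReal
  have hX : Measurable fun ω (e : ℕ × Fin k × Fin ℓ) => X e.1 e.2.1 e.2.2 ω :=
    measurable_pi_lambda _ fun e => h.measurable _ _ _
  calc ∫⁻ ω, (completionTime a (fun t i j => X t i j ω) : ℝ≥0∞) ∂P
      = ∫⁻ ω, ∑' t, ENNReal.ofReal (busy a t fun e => X e.1 e.2.1 e.2.2 ω) ∂P :=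
        lintegral_congr fun ω => completionTime_eq_tsum a fun e => X e.1 e.2.1 e.2.2 ω
    _ = ∫⁻ x, ∑' t, ENNReal.ofReal (busy a t x) ∂erasureMeasure p := by
        rw [← h.map_eq, lintegral_map (Measurable.tsum hm) hX]
    _ = ∑' t, ENNReal.ofReal (busyProb p a t) := by
        rw [lintegral_tsum fun t => (hm t).aemeasurable]
        refine tsum_congr fun t => ?_
        rw [busyProb, ofReal_integral_eq_lintegral_ofReal
          (integrable_erasureMeasure hp0 hp1 (dependsOn_busy a t))
          (ae_of_all _ (busy_nonneg a t))]

lemma variance_centredSuccess_pos {q : ℝ} (hq0 : 0 < q) (hq1 : q < 1) :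
    0 < q * centredSuccess (1 - q) true ^ 2 + (1 - q) * centredSuccess (1 - q) false ^ 2 := by
  have : 0 ≤ (1 - q) * centredSuccess (1 - q) false ^ 2 :=
    mul_nonneg (by linarith) (sq_nonneg _)
  have : centredSuccess (1 - q) true = -1 := by simp [centredSuccess]
  rw [this]
  linarith

end ParallelRouting

open ParallelRouting in
theorem theorem3 {k ℓ : ℕ} (hk : 2 ≤ k) (hℓ : 1 ≤ ℓ) (p : Fin k → Fin ℓ → ℝ)
    (hp0 : ∀ i j, 0 ≤ p i j) (hp1 : ∀ i j, p i j < 1) (hpos : ∃ i j, 0 < p i j)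
    (a : ℕ → Fin k → ℕ) (ha : ∀ n, ParallelRouting.IsProportionalSplit p n (a n)) :
    ∃ D : ℕ → ℝ,
      (∀ (Ω : Type*) [MeasurableSpace Ω] (P : Measure Ω) [IsProbabilityMeasure P]
        (X : ℕ → Fin k → Fin ℓ → Ω → Bool), ParallelRouting.IsErasureProcess p P X →
        ∀ n : ℕ,
          ∫⁻ ω, (ParallelRouting.completionTime (a n) (fun t i j => X t i j ω) : ℝ≥0∞) ∂P ≠ ∞ ∧
          (∫⁻ ω, (ParallelRouting.completionTime (a n) (fun t i j => X t i j ω) : ℝ≥0∞) ∂P).toReal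
            = (n : ℝ) / ((k : ℝ) - ∑ i, ⨆ j, p i j) + D n) ∧
      (D =o[atTop] fun n : ℕ => (n : ℝ)) ∧
      (∃ c : ℝ, 0 < c ∧ ∀ᶠ n : ℕ in atTop, c * √(n : ℝ) ≤ D n) := by
  have hp1' : ∀ i j, p i j ≤ 1 := fun i j => (hp1 i j).le
  have : Nonempty (Fin ℓ) := ⟨⟨0, hℓ⟩⟩
  have : Nontrivial (Fin k) := Fin.nontrivial_iff_two_le.2 hk
  -- `b i` is a bottleneck link of path `i`.
  choose b hb using fun i => exists_eq_ciSup_of_finite (f := p i)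
  set s : Fin k → ℝ := fun i => 1 - p i (b i) with hs
  have hs0 : ∀ i, 0 < s i := fun i => sub_pos.2 (hp1 _ _)
  have hs1 : ∀ i, s i ≤ 1 := fun i => sub_le_self _ (hp0 _ _)
  have hsle : ∀ i j, s i ≤ 1 - p i j := fun i j => by
    have := le_ciSup (Set.finite_range (p i)).bddAbove j
    rw [← hb i] at this
    simp only [hs]; linarith
  set C : ℝ := (k : ℝ) - ∑ i, ⨆ j, p i j with hC
  have hCs : C = ∑ i, s i := by simp [hC, hs, ← hb]
  have hC0 : 0 < C := by
    rw [hCs]; exact Finset.sum_pos (fun i _ => hs0 i) Finset.univ_nonempty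
  obtain ⟨i₀, hi₀⟩ := Finite.exists_min s
  set σ := s i₀ with hσ
  have hσ0 : 0 < σ := hs0 i₀
  have hshare : ∀ n i, share p n i = n * s i / C := fun n i => by
    simp [share, capacity, hs, ← hb, hC]
  have hsplit : ∀ n i, |(a n i : ℝ) - n * s i / C| ≤ 1 := fun n i => by
    rw [← hshare]; exact ha n i
  -- Rounding by one packet shifts `a i / s i` by at most `1 / σ`.
  have hσi : ∀ i, 1 ≤ s i * (1 / σ) := fun i => by
    rw [mul_one_div, one_le_div hσ0]; exact hi₀ i
  have hup : ∀ n i, (a n i : ℝ) ≤ s i * (n / C + 1 / σ) := fun n i => by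
    have h1 := (abs_le.1 (hsplit n i)).2
    have h2 := hσi i
    have h3 : s i * (n / C + 1 / σ) = n * s i / C + s i * (1 / σ) := by ring
    linarith
  have hlow : ∀ (n : ℕ) i, (n / C - 1 / σ : ℝ) ≤ a n i / s i := fun n i => by
    have h1 := (abs_le.1 (hsplit n i)).1
    have h2 := hσi i
    have h3 : (n / C - 1 / σ) * s i = n * s i / C - s i * (1 / σ) := by ring
    rw [le_div_iff₀ (hs0 i)]
    linarith
  have hbound := fun {δ : ℝ} (hδ : 0 < δ) =>
    exists_tsum_busyProb_le hp0 hp1' hδ hσ0 hi₀ hs1 hsle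
  have hsum : ∀ n, Summable (busyProb p (a n)) := fun n => by
    obtain ⟨K, hK⟩ := hbound one_pos
    exact (hK (a n) _ (by positivity) (hup n)).1
  have hlower : ∃ c : ℝ, 0 < c ∧
      ∀ᶠ n : ℕ in atTop, c * √(n : ℝ) ≤ ∑' t, busyProb p (a n) t - n / C := by
    obtain ⟨i₁, j, hj⟩ := hpos
    obtain ⟨i₂, hi⟩ := exists_ne i₁
    have hq : 0 < p i₁ (b i₁) := by linarith [hsle i₁ j, show s i₁ = 1 - p i₁ (b i₁) from rfl]
    obtain ⟨c, hc0, hc⟩ := exists_sqrt_le_integral_abs_linkWalk hp0 hp1'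
      (mean_centredSuccess (hp1 i₁ (b i₁))) (variance_centredSuccess_pos hq (hp1 i₁ (b i₁)))
    have hmain : ∀ n : ℕ, n / C - 1 / σ + c * √(a n i₁ : ℝ) / 2 ≤ ∑' t, busyProb p (a n) t := by
      intro n
      -- The truncation error at the horizon vanishes because `busyProb` is summable.
      have ht : Tendsto (fun N => n / C - 1 / σ - (a n i₁ / s i₁ + a n i₂ / s i₂) *
          busyProb p (a n) N + c * √(a n i₁ : ℝ) / 2) atTop
          (nhds (n / C - 1 / σ - (a n i₁ / s i₁ + a n i₂ / s i₂) * 0 +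
            c * √(a n i₁ : ℝ) / 2)) :=
        (((hsum n).tendsto_atTop_zero.const_mul _).const_sub _).add_const _
      rw [mul_zero, sub_zero] at ht
      refine le_of_tendsto ht ?_
      filter_upwards [eventually_ge_atTop (a n i₁)] with N hN
      have h1 := le_sum_busyProb hℓ hp0 hp1 hi.symm (b i₁) (b i₂) (hlow n i₁) (hlow n i₂) hN
      have h2 := (hsum n).sum_le_tsum (Finset.range N) fun t _ => busyProb_nonneg (a n) t
      linarith [hc (a n i₁)]
    set c' := c * √(s i₁ / (2 * C)) / 2 with hc'
    have hc'0 : 0 < c' := by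
      have := hs0 i₁
      positivity
    refine ⟨c' / 2, by positivity, ?_⟩
    have hsqrt : Tendsto (fun n : ℕ => √(n : ℝ)) atTop atTop :=
      Real.tendsto_sqrt_atTop.comp tendsto_natCast_atTop_atTop
    -- The first condition makes `a n i₁` at least half of its share; the second lets half of `c'
    -- √n` absorb `1 / σ`.
    filter_upwards [tendsto_natCast_atTop_atTop.eventually_ge_atTop (2 * C / s i₁),
      hsqrt.eventually_ge_atTop (1 / σ / (c' / 2))] with n hn1 hn2
    rw [div_le_iff₀ (by positivity)] at hn2
    rw [div_le_iff₀ (hs0 i₁)] at hn1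
    have h1 := (abs_le.1 (hsplit n i₁)).1
    have h2 : n * (s i₁ / (2 * C)) ≤ a n i₁ := by
      have e : (n : ℝ) * s i₁ / C = 2 * (n * (s i₁ / (2 * C))) := by field_simp
      have : 1 ≤ n * (s i₁ / (2 * C)) := by
        rw [← mul_div_assoc, one_le_div (by positivity)]; exact hn1
      linarith
    have h3 := Real.sqrt_le_sqrt h2
    rw [Real.sqrt_mul (Nat.cast_nonneg n)] at h3
    have h4 := mul_le_mul_of_nonneg_left h3 (by positivity : 0 ≤ c / 2)
    have h5 := hmain n
    have h6 : c / 2 * (√(n : ℝ) * √(s i₁ / (2 * C))) = c' * √(n : ℝ) := by rw [hc']; ring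
    linarith
  refine ⟨fun n => ∑' t, busyProb p (a n) t - n / C, ?_, ?_, hlower⟩
  · intro Ω _ P _ X hX n
    rw [hX.lintegral_completionTime hp0 hp1',
      ← ENNReal.ofReal_tsum_of_nonneg (busyProb_nonneg (a n)) (hsum n)]
    refine ⟨ENNReal.ofReal_ne_top, ?_⟩
    rw [ENNReal.toReal_ofReal (tsum_nonneg (busyProb_nonneg (a n)))]
    ring
  · obtain ⟨c, hc0, hc⟩ := hlower
    rw [isLittleO_iff]
    intro ε hε
    -- Then `(1 + δ)² - 1 ≤ 3 δ ≤ ε C / 2`, which uses half of `ε`; the other half absorbs the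
    -- constants for large `n`.
    set δ := min 1 (ε * C / 6) with hδ
    have hδ0 : 0 < δ := by positivity
    have hδ1 : δ ≤ 1 := min_le_left _ _
    have hδ2 : δ ≤ ε * C / 6 := min_le_right _ _
    obtain ⟨K, hK⟩ := hbound hδ0
    filter_upwards [hc, tendsto_natCast_atTop_atTop.eventually_ge_atTop
      (((1 + δ) ^ 2 * (1 / σ) + K) / (ε / 2))] with n hn1 hn2
    rw [div_le_iff₀ (by positivity)] at hn2
    have h1 := (hK (a n) _ (by positivity) (hup n)).2
    have h2 : 0 ≤ c * √(n : ℝ) := by positivity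
    -- The lower bound makes the delay eventually nonnegative, so an upper bound suffices.
    rw [Real.norm_of_nonneg (h2.trans hn1), Real.norm_of_nonneg (Nat.cast_nonneg n)]
    have h3 : ((1 + δ) ^ 2 - 1) * (n / C) ≤ ε / 2 * n := by
      have h4 : (1 + δ) ^ 2 - 1 ≤ ε * C / 2 := by nlinarith
      calc ((1 + δ) ^ 2 - 1) * (n / C) ≤ ε * C / 2 * (n / C) :=
            mul_le_mul_of_nonneg_right h4 (by positivity)
        _ = ε / 2 * n := by field_simp
    linarith
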